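/- Let $n, d$ be dimensions and let $\mathbb T^n = (\mathbb R/\mathbb Z)^n$ carry the measure induced by Lebesgue measure (of total mass $1$), with respect to which $\|\cdot\|_{L^2}$ is taken. Let $X \subset \mathbb R^d$ be nonempty, let $P$ be a fully supported Borel probability measure on $\mathbb T^n$ (that is, $P(U) > 0$ for every nonempty open $U$), and let $f : X \times \mathbb T^n \to \mathbb R$ be lower semicontinuous. Suppose that there is an integer $s > n/2$ such that $f(x,\cdot)$ is $s$ times continuously differentiable on $\mathbb T^n$ for every $x \in X$, and that $$M := \sup_{x \in X} \|f(x,\cdot)\|_{L^2} < \infty, \qquad L := \sup_{x \in X} \sum_{i=1}^n \Big\|\frac{\partial^s f(x,\cdot)}{\partial u_i^s}\Big\|_{L^2} < \infty .$$ Put $v^* := \inf_{x \in X} \sup_{u \in \mathbb T^n} f(x,u)$ and, for $\delta > 0$, $p(\delta) := \inf_{x \in X} P\big(\{u \in \mathbb T^n : f(x,u) > v^* - \delta\}\big)$. Then for every integer $N \ge 1$ and every $\varepsilon > 0$, $$P^N\Big(\Big\{(u_1,\dots,u_N) \in (\mathbb T^n)^N : \inf_{x \in X} \max_{1 \le i \le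 N} f(x,u_i) \le v^* - \varepsilon\Big\}\Big) \le \frac{1}{D(\varepsilon)} \Big(\frac{\pi D(\varepsilon)^2}{2}\Big)^{D(\varepsilon)} \Big(\frac{\varepsilon}{24 M}\Big)^{-2D(\varepsilon)} \exp\big(-N\, p(\varepsilon/4)\big),$$ where $$D(\varepsilon) := \Bigg(2\Bigg\lceil \bigg(\frac{12\sqrt 2\; 2^n L}{(2\pi)^s\, \varepsilon}\bigg)^{\frac{2}{2s-n}} \Bigg\rceil + 1\Bigg)^n .$$ If $M = 0$, the factor $(\varepsilon/(24M))^{-2D(\varepsilon)} = (24M/\varepsilon)^{2D(\varepsilon)}$ is read as $0$. -/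

import Mathlib

open MeasureTheory

noncomputable section

namespace Scenario

section General

variable {X Ξ : Type*}

/-- The optimal value `inf_x sup_u f(x,u)` of the robust minmax problem. -/
def robustValue (f : X → Ξ → ℝ) : ℝ := ⨅ x, ⨆ u, f x u

/-- The optimal value `inf_x max_i f(x,u_i)` of the scenario problem for the sample `u`. -/
def scenarioValue (f : X → Ξ → ℝ) {N : ℕ} (u : Fin N → Ξ) : ℝ := ⨅ x, ⨆ i, f x (u i)

/-- The bad samples of size `N`: those whose scenario value is at most the robust value minus
the accuracy `ε`. -/
def badSet (f : X → Ξ → ℝ) (N : ℕ) (ε : ℝ) : Set (Fin N → Ξ) :=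
  {u | scenarioValue f u ≤ robustValue f - ε}

/-- The probability of the bad set for `N` independent samples distributed according to `P`. -/
def badSetProb [MeasurableSpace Ξ] (P : Measure Ξ) (f : X → Ξ → ℝ) (N : ℕ) (ε : ℝ) : ℝ :=
  (Measure.pi fun _ : Fin N => P).real (badSet f N ε)

/-- The tail probability `p(x, ε)`. -/
def tailProb [MeasurableSpace Ξ] (P : Measure Ξ) (f : X → Ξ → ℝ) (x : X) (ε : ℝ) : ℝ :=
  P.real {u | robustValue f - ε < f x u}

/-- The infimum `p(ε)` of the tail probabilities over all decisions. -/
def infTailProb [MeasurableSpace Ξ] (P : Measure Ξ) (f : X → Ξ → ℝ) (ε : ℝ) : ℝ :=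
  ⨅ x, tailProb P f x ε

end General

section Torus

variable {n : ℕ}

/-- `g` is `s` times continuously differentiable on the torus `ℝⁿ/ℤⁿ`, that is, its periodic lift
to `ℝⁿ` is. -/
def TorusContDiff (s : ℕ) (g : UnitAddTorus (Fin n) → ℝ) : Prop :=
  ContDiff ℝ s fun v : Fin n → ℝ => g fun i => (v i : UnitAddCircle)

/-- The pure partial derivative `∂ˢg/∂u_iˢ` at `u`: the `s`-th derivative at `t = 0` of
`t ↦ g (u + t e_i)`. -/
def purePartial (s : ℕ) (i : Fin n) (g : UnitAddTorus (Fin n) → ℝ) (u : UnitAddTorus (Fin n)) :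
    ℝ :=
  iteratedDeriv s (fun t : ℝ => g (u + Pi.single i (t : UnitAddCircle))) 0

/-- The `L²` norm of a function on the torus, for the measure induced by Lebesgue measure
(the product of the Haar measures of total mass one on `ℝ/ℤ`). -/
def torusL2Norm (g : UnitAddTorus (Fin n) → ℝ) : ℝ :=
  √(∫ u, g u ^ 2 ∂(Measure.pi fun _ : Fin n => (AddCircle.haarAddCircle : Measure UnitAddCircle)))

/-- The frequency threshold `(√2 · 2ⁿ · L / ((2π)ˢ δ)) ^ (2 / (2s - n))`. -/
def freqBound (n s : ℕ) (L δ : ℝ) : ℝ :=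
  (√2 * 2 ^ n * L / ((2 * Real.pi) ^ s * δ)) ^ (2 / (2 * (s : ℝ) - n))

/-- `D(ε) = (2 ⌈N(ε)⌉ + 1) ^ n`, where `N(ε)` is the frequency threshold at `ε / 12`. -/
def trigDim (n s : ℕ) (L ε : ℝ) : ℕ := (2 * ⌈freqBound n s L (ε / 12)⌉₊ + 1) ^ n

end Torus

end Scenario

end

/-! The idea is to replace the decision set by a finite sup-norm net and use a union bound. Write `q
= 2s - n`, which is positive. The `s`-th pure derivatives multiply the coefficient at `k` by `(2πi
k_i)^s`, so Parseval bounds the coefficients weighted by `‖k‖^s` in `ℓ²`. Cauchy–Schwarz against `∑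
‖k‖^(-2s)`, which converges outside a box like `K^(-q)`, bounds the Fourier tail uniformly in `x`
(`TorusContDiff.sum_norm_torusCoeff_le`).

At tail accuracy `ε/12`, each `f x` is therefore described by `D` coefficients of modulus at most
`M`. Rounding them with mesh `ε/(4D)` (`exists_finset_net`) gives finitely many decisions such that
every `f x` is within `2ε/3 < ε - ε/4` of one of them. A bad sample then misses the `ε/4`-tail of
some net decision, which has probability at most `(1 - p)^N ≤ exp(-N p)`
(`badSetProb_le_card_mul_exp`).

The net size fits under the stated constant only if `D * M ≥ 3ε/8` (`net_card_le`). Otherwise the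
costs are too small for any bad sample to exist (`badSet_eq_empty`). -/

namespace Scenario

/-! ### Differentiation along the circle directions of the torus. -/

section Torus

variable {n : ℕ}

/-- The product Haar probability measure on the torus. -/
noncomputable abbrev torusHaar (n : ℕ) : Measure (UnitAddTorus (Fin n)) :=
  Measure.pi fun _ : Fin n => (AddCircle.haarAddCircle : Measure UnitAddCircle)

/-- The first partial derivative of `g` on the torus in the direction `i`. -/
noncomputable def torusDeriv (i : Fin n) (g : UnitAddTorus (Fin n) → ℝ)
    (u : UnitAddTorus (Fin n)) : ℝ :=
  deriv (fun t : ℝ => g (u + Pi.single i (t : UnitAddCircle))) 0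

/-- The projection `ℝⁿ → ℝⁿ/ℤⁿ`. -/
def torusMk (v : Fin n → ℝ) : UnitAddTorus (Fin n) := fun i => (v i : UnitAddCircle)

theorem isOpenQuotientMap_torusMk : IsOpenQuotientMap (torusMk (n := n)) :=
  IsOpenQuotientMap.piMap fun _ => QuotientAddGroup.isOpenQuotientMap_mk

theorem torusMk_add_single (v : Fin n → ℝ) (i : Fin n) (t : ℝ) :
    torusMk v + Pi.single i (t : UnitAddCircle) = torusMk (v + t • Pi.single i 1) := by
  funext j
  rcases eq_or_ne j i with rfl | h
  · simp [torusMk]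
  · simp [torusMk, h]

theorem single_coe_add (i : Fin n) (a b : ℝ) :
    (Pi.single i ((a + b : ℝ) : UnitAddCircle) : UnitAddTorus (Fin n)) =
      Pi.single i (a : UnitAddCircle) + Pi.single i (b : UnitAddCircle) := by
  rw [← Pi.single_add, AddCircle.coe_add]

theorem TorusContDiff.continuous {s : ℕ} {g : UnitAddTorus (Fin n) → ℝ}
    (hg : TorusContDiff s g) : Continuous g :=
  isOpenQuotientMap_torusMk.isQuotientMap.continuous_iff.2 (ContDiff.continuous hg)

theorem TorusContDiff.of_le {s r : ℕ} {g : UnitAddTorus (Fin n) → ℝ}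
    (hg : TorusContDiff s g) (h : r ≤ s) : TorusContDiff r g :=
  ContDiff.of_le hg (by exact_mod_cast h)

theorem TorusContDiff.contDiff_slice {s : ℕ} {g : UnitAddTorus (Fin n) → ℝ}
    (hg : TorusContDiff s g) (i : Fin n) (u : UnitAddTorus (Fin n)) :
    ContDiff ℝ s fun t : ℝ => g (u + Pi.single i (t : UnitAddCircle)) := by
  obtain ⟨v, rfl⟩ := isOpenQuotientMap_torusMk.surjective u
  simp_rw [torusMk_add_single]
  exact ContDiff.comp (g := fun v => g (torusMk v)) hg (by fun_prop)

/-- Moving the base point along the slice turns a derivative at `t` into one at `0`; this is what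
lets iterated derivatives be computed on the torus itself. -/
theorem deriv_slice (i : Fin n) (g : UnitAddTorus (Fin n) → ℝ) (u : UnitAddTorus (Fin n)) :
    deriv (fun t : ℝ => g (u + Pi.single i (t : UnitAddCircle))) =
      fun t : ℝ => torusDeriv i g (u + Pi.single i (t : UnitAddCircle)) := by
  funext t
  have h := deriv_comp_const_add (fun t : ℝ => g (u + Pi.single i (t : UnitAddCircle))) t 0
  rw [add_zero] at h
  rw [← h, torusDeriv]
  simp_rw [single_coe_add, add_assoc]

theorem TorusContDiff.hasDerivAt_slice {s : ℕ} {g : UnitAddTorus (Fin n) → ℝ}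
    (hg : TorusContDiff (s + 1) g) (i : Fin n) (u : UnitAddTorus (Fin n)) (t : ℝ) :
    HasDerivAt (fun t : ℝ => g (u + Pi.single i (t : UnitAddCircle)))
      (torusDeriv i g (u + Pi.single i (t : UnitAddCircle))) t := by
  have h := ((hg.contDiff_slice i u).differentiable (by simp) t).hasDerivAt
  rwa [deriv_slice] at h

theorem TorusContDiff.torusDeriv {s : ℕ} {g : UnitAddTorus (Fin n) → ℝ}
    (hg : TorusContDiff (s + 1) g) (i : Fin n) : TorusContDiff s (torusDeriv i g) := by
  have hG : ContDiff ℝ (s + 1) fun v : Fin n → ℝ => g (torusMk v) := by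
    have := hg
    unfold TorusContDiff at this
    exact_mod_cast this
  have h : (fun v : Fin n → ℝ => Scenario.torusDeriv i g (torusMk v)) =
      fun v => fderiv ℝ (fun v : Fin n → ℝ => g (torusMk v)) v (Pi.single i 1) := by
    funext v
    have hd := (hG.differentiable (by simp) v).lineDeriv_eq_fderiv (v := Pi.single i (1 : ℝ))
    rw [← hd, lineDeriv, Scenario.torusDeriv]
    simp_rw [torusMk_add_single]
  change ContDiff ℝ s (fun v : Fin n → ℝ => Scenario.torusDeriv i g (torusMk v))
  rw [h]
  exact (hG.fderiv_right (m := s) le_rfl).clm_apply contDiff_const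

theorem purePartial_zero (i : Fin n) (g : UnitAddTorus (Fin n) → ℝ) : purePartial 0 i g = g := by
  funext u
  simp [purePartial]

/-- Peeling off the innermost derivative makes inductions on `s` with `g` generalized possible. -/
theorem purePartial_succ (s : ℕ) (i : Fin n) (g : UnitAddTorus (Fin n) → ℝ) :
    purePartial (s + 1) i g = purePartial s i (torusDeriv i g) := by
  funext u
  rw [purePartial, purePartial, iteratedDeriv_succ', deriv_slice]

theorem TorusContDiff.continuous_purePartial {s : ℕ} {g : UnitAddTorus (Fin n) → ℝ}
    (hg : TorusContDiff s g) (i : Fin n) : Continuous (purePartial s i g) := by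
  induction s generalizing g with
  | zero => rw [purePartial_zero]; exact hg.continuous
  | succ s ih => rw [purePartial_succ]; exact ih (hg.torusDeriv i)

/-! ### Fourier coefficients of derivatives, and Parseval. -/

/-- The Fourier coefficients of a real function on the torus. -/
noncomputable def torusCoeff (g : UnitAddTorus (Fin n) → ℝ) (k : Fin n → ℤ) : ℂ :=
  UnitAddTorus.mFourierCoeff (fun u => (g u : ℂ)) k

theorem torusCoeff_eq (g : UnitAddTorus (Fin n) → ℝ) (k : Fin n → ℤ) :
    torusCoeff g k = ∫ u, UnitAddTorus.mFourier (-k) u * (g u : ℂ) ∂torusHaar n := rfl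

theorem mFourier_add_apply (k : Fin n → ℤ) (u v : UnitAddTorus (Fin n)) :
    UnitAddTorus.mFourier k (u + v) =
      UnitAddTorus.mFourier k u * UnitAddTorus.mFourier k v := by
  simp [UnitAddTorus.mFourier, fourier_apply, AddCircle.toCircle_add, Finset.prod_mul_distrib]

theorem mFourier_single_apply (k : Fin n → ℤ) (i : Fin n) (t : ℝ) :
    UnitAddTorus.mFourier k (Pi.single i (t : UnitAddCircle)) =
      Complex.exp (2 * Real.pi * Complex.I * k i * t) := by
  change ∏ j, fourier (k j) ((Pi.single i (t : UnitAddCircle) : UnitAddTorus (Fin n)) j) = _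
  rw [Finset.prod_eq_single i]
  · rw [Pi.single_eq_same, fourier_coe_apply]
    simp
  · intro j _ hj
    rw [Pi.single_eq_of_ne hj, fourier_eval_zero]
  · simp

theorem integral_mFourier_mul_translate (g : UnitAddTorus (Fin n) → ℝ) (k : Fin n → ℤ)
    (i : Fin n) (t : ℝ) :
    ∫ u, UnitAddTorus.mFourier (-k) u * (g (u + Pi.single i (t : UnitAddCircle)) : ℂ)
        ∂torusHaar n =
      Complex.exp (2 * Real.pi * Complex.I * k i * t) * torusCoeff g k := by
  rw [torusCoeff_eq, ← integral_add_right_eq_self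
    (fun u => UnitAddTorus.mFourier (-k) u * (g u : ℂ)) (Pi.single i (t : UnitAddCircle)),
    ← integral_const_mul]
  refine integral_congr_ae (Filter.Eventually.of_forall fun u => ?_)
  simp only
  rw [mFourier_add_apply, mFourier_single_apply]
  have : Complex.exp (2 * Real.pi * Complex.I * k i * t) *
      Complex.exp (2 * Real.pi * Complex.I * (-k) i * t) = 1 := by
    rw [← Complex.exp_add]
    simp
  linear_combination (-(UnitAddTorus.mFourier (-k) u) *
    (g (u + Pi.single i (t : UnitAddCircle)) : ℂ)) * this

theorem norm_mFourier_apply_le (k : Fin n → ℤ) (u : UnitAddTorus (Fin n)) :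
    ‖UnitAddTorus.mFourier k u‖ ≤ 1 :=
  (ContinuousMap.norm_coe_le_norm _ u).trans_eq UnitAddTorus.mFourier_norm

/-- Differentiation of a family of integrals over a compact space whose derivative is uniformly
bounded. -/
theorem hasDerivAt_integral_mul_of_bounded {Ω : Type*} [TopologicalSpace Ω] [CompactSpace Ω]
    [MeasurableSpace Ω] [OpensMeasurableSpace Ω] {μ : Measure Ω} [IsFiniteMeasure μ]
    {φ : Ω → ℂ} {h h' : ℝ → Ω → ℝ} {C : ℝ} (hφ : Continuous φ) (hφ1 : ∀ u, ‖φ u‖ ≤ 1)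
    (hc : ∀ t, Continuous (h t)) (hc' : ∀ t, Continuous (h' t)) (hC : ∀ t u, ‖h' t u‖ ≤ C)
    (hd : ∀ t u, HasDerivAt (fun t => h t u) (h' t u) t) (t : ℝ) :
    HasDerivAt (fun t => ∫ u, φ u * (h t u : ℂ) ∂μ) (∫ u, φ u * (h' t u : ℂ) ∂μ) t := by
  have hint : ∀ G : Ω → ℝ, Continuous G → Integrable (fun u => φ u * (G u : ℂ)) μ := by
    intro G hG
    have hc : Continuous fun u => φ u * (G u : ℂ) :=
      hφ.mul (Complex.continuous_ofReal.comp hG)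
    exact hc.integrable_of_hasCompactSupport (HasCompactSupport.of_compactSpace _)
  refine (hasDerivAt_integral_of_dominated_loc_of_deriv_le (μ := μ) (𝕜 := ℝ)
    (F := fun t u => φ u * (h t u : ℂ)) (F' := fun t u => φ u * (h' t u : ℂ))
    (x₀ := t) (s := Set.univ) (bound := fun _ => C) Filter.univ_mem
    (Filter.Eventually.of_forall fun t => (hint _ (hc t)).aestronglyMeasurable)
    (hint _ (hc t)) (hint _ (hc' t)).aestronglyMeasurable
    (Filter.Eventually.of_forall fun u t _ => ?_) (integrable_const C)
    (Filter.Eventually.of_forall fun u t _ => ?_)).2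
  · rw [norm_mul, Complex.norm_real]
    calc _ ≤ 1 * C := mul_le_mul (hφ1 u) (hC t u) (norm_nonneg _) zero_le_one
      _ = C := one_mul C
  · exact ((hd t u).ofReal_comp).const_mul _

theorem TorusContDiff.hasDerivAt_integral_mul {g : UnitAddTorus (Fin n) → ℝ}
    (hg : TorusContDiff 1 g) (i : Fin n) {φ : UnitAddTorus (Fin n) → ℂ} (hφ : Continuous φ)
    (hφ1 : ∀ u, ‖φ u‖ ≤ 1) :
    HasDerivAt (fun t : ℝ => ∫ u, φ u * (g (u + Pi.single i (t : UnitAddCircle)) : ℂ)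
        ∂torusHaar n)
      (∫ u, φ u * (Scenario.torusDeriv i g (u + Pi.single i ((0 : ℝ) : UnitAddCircle)) : ℂ)
        ∂torusHaar n) 0 := by
  have hdc : Continuous (Scenario.torusDeriv i g) :=
    (TorusContDiff.torusDeriv (s := 0) hg i).continuous
  obtain ⟨C, hC⟩ := isCompact_univ.exists_bound_of_continuousOn hdc.continuousOn
  exact hasDerivAt_integral_mul_of_bounded (μ := torusHaar n) (C := C)
    (h := fun t u => g (u + Pi.single i (t : UnitAddCircle)))
    (h' := fun t u => Scenario.torusDeriv i g (u + Pi.single i (t : UnitAddCircle))) hφ hφ1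
    (fun t => hg.continuous.comp (continuous_add_const _))
    (fun t => hdc.comp (continuous_add_const _)) (fun t u => hC _ (Set.mem_univ _))
    (fun t u => hg.hasDerivAt_slice (s := 0) i u t) 0

/-- Translation replaces integration by parts: by invariance of Haar measure, translating `g` by `t
e_i` multiplies its coefficient by `exp(2πi k_i t)`. Differentiating this at `t = 0`, once under the
integral and once explicitly, gives the two sides. -/
theorem TorusContDiff.torusCoeff_torusDeriv {g : UnitAddTorus (Fin n) → ℝ}
    (hg : TorusContDiff 1 g) (i : Fin n) (k : Fin n → ℤ) :
    torusCoeff (Scenario.torusDeriv i g) k =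
      2 * Real.pi * Complex.I * k i * torusCoeff g k := by
  have h2 := hg.hasDerivAt_integral_mul i (UnitAddTorus.mFourier (-k)).continuous
    (norm_mFourier_apply_le (-k))
  simp_rw [integral_mFourier_mul_translate] at h2
  have h3 : HasDerivAt (fun t : ℝ => Complex.exp (2 * Real.pi * Complex.I * k i * t) *
      torusCoeff g k) (2 * Real.pi * Complex.I * k i * torusCoeff g k) 0 := by
    have h4 : HasDerivAt (fun t : ℂ => Complex.exp (2 * Real.pi * Complex.I * k i * t))
        (Complex.exp (2 * Real.pi * Complex.I * k i * (0 : ℝ)) *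
          (2 * Real.pi * Complex.I * k i * 1)) (0 : ℝ) :=
      ((hasDerivAt_id _).const_mul _).cexp
    have h5 := (h4.comp_ofReal).mul_const (torusCoeff g k)
    simpa using h5
  have h6 := h2.unique h3
  simpa using h6

theorem TorusContDiff.torusCoeff_purePartial {s : ℕ} {g : UnitAddTorus (Fin n) → ℝ}
    (hg : TorusContDiff s g) (i : Fin n) (k : Fin n → ℤ) :
    torusCoeff (purePartial s i g) k =
      (2 * Real.pi * Complex.I * k i) ^ s * torusCoeff g k := by
  induction s generalizing g with
  | zero => simp [purePartial_zero]
  | succ s ih =>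
    rw [purePartial_succ, ih (hg.torusDeriv i),
      (hg.of_le (Nat.le_add_left 1 s)).torusCoeff_torusDeriv, pow_succ]
    ring

theorem torusL2Norm_nonneg (g : UnitAddTorus (Fin n) → ℝ) : 0 ≤ torusL2Norm g :=
  Real.sqrt_nonneg _

theorem hasSum_sq_torusCoeff {g : UnitAddTorus (Fin n) → ℝ} (hg : Continuous g) :
    HasSum (fun k => ‖torusCoeff g k‖ ^ 2) (torusL2Norm g ^ 2) := by
  let G : C(UnitAddTorus (Fin n), ℂ) := ⟨fun u => (g u : ℂ), by fun_prop⟩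
  have h := UnitAddTorus.hasSum_sq_mFourierCoeff (ContinuousMap.toLp 2 (torusHaar n) ℂ G)
  have h1 : ∀ k, UnitAddTorus.mFourierCoeff (ContinuousMap.toLp 2 (torusHaar n) ℂ G) k =
      torusCoeff g k := fun k => UnitAddTorus.mFourierCoeff_toLp G k
  simp_rw [h1] at h
  convert h using 1
  rw [torusL2Norm, Real.sq_sqrt (integral_nonneg fun _ => sq_nonneg _)]
  refine integral_congr_ae ?_
  filter_upwards [ContinuousMap.coeFn_toLp (p := 2) (𝕜 := ℂ) (torusHaar n) G] with u hu
  rw [hu]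
  simp [G]

theorem hasSum_torusCoeff_mul_mFourier {g : UnitAddTorus (Fin n) → ℝ} (hg : Continuous g)
    (h : Summable fun k => ‖torusCoeff g k‖) (u : UnitAddTorus (Fin n)) :
    HasSum (fun k => torusCoeff g k * UnitAddTorus.mFourier k u) (g u : ℂ) := by
  let G : C(UnitAddTorus (Fin n), ℂ) := ⟨fun u => (g u : ℂ), by fun_prop⟩
  exact UnitAddTorus.hasSum_mFourier_series_apply_of_summable (f := G) (.of_norm h) u

theorem norm_torusCoeff_le {g : UnitAddTorus (Fin n) → ℝ} (hg : Continuous g)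
    (k : Fin n → ℤ) : ‖torusCoeff g k‖ ≤ torusL2Norm g :=
  le_of_sq_le_sq (le_hasSum (hasSum_sq_torusCoeff hg) k fun _ _ => sq_nonneg _)
    (torusL2Norm_nonneg g)

end Torus

end Scenario

namespace Scenario

/-! ### Counting lattice points and truncating the Fourier series. -/

section Torus

variable {n : ℕ}

/-- The multi-indices all of whose entries are at most `K` in absolute value. -/
noncomputable def freqBox (n K : ℕ) : Finset (Fin n → ℤ) := Finset.Icc (fun _ => -(K : ℤ)) fun _ => (K : ℤ)

theorem card_freqBox (n K : ℕ) : (freqBox n K).card = (2 * K + 1) ^ n := by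
  rw [freqBox, Pi.card_Icc]
  simp only [Int.card_Icc, Finset.prod_const, Finset.card_univ, Fintype.card_fin]
  congr 1
  omega

theorem mem_freqBox {K : ℕ} {k : Fin n → ℤ} : k ∈ freqBox n K ↔ ∀ i, |k i| ≤ K := by
  simp only [freqBox, Finset.mem_Icc, Pi.le_def, abs_le, forall_and]

theorem mem_freqBox_iff_norm_le {K : ℕ} {k : Fin n → ℤ} : k ∈ freqBox n K ↔ ‖k‖ ≤ K := by
  rw [mem_freqBox, pi_norm_le_iff_of_nonneg (Nat.cast_nonneg K)]
  refine forall_congr' fun i => ?_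
  rw [Int.norm_eq_abs]
  exact_mod_cast Iff.rfl

theorem freqBox_mono {K J : ℕ} (h : K ≤ J) : freqBox n K ⊆ freqBox n J := fun k hk => by
  rw [mem_freqBox_iff_norm_le] at hk ⊢
  exact hk.trans (by exact_mod_cast h)

theorem exists_subset_freqBox (F : Finset (Fin n → ℤ)) (K : ℕ) :
    ∃ J, K ≤ J ∧ F ⊆ freqBox n J := by
  refine ⟨max K (F.sup fun k => ⌈‖k‖⌉₊), le_max_left _ _, fun k hk => ?_⟩
  rw [mem_freqBox_iff_norm_le]
  calc ‖k‖ ≤ ⌈‖k‖⌉₊ := Nat.le_ceil _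
    _ ≤ _ := by
      exact_mod_cast (Finset.le_sup (f := fun k : Fin n → ℤ => ⌈‖k‖⌉₊) hk).trans
        (le_max_right _ _)

theorem le_norm_of_notMem_freqBox {K : ℕ} {k : Fin n → ℤ} (hk : k ∉ freqBox n K) :
    (K + 1 : ℝ) ≤ ‖k‖ := by
  rw [mem_freqBox] at hk
  push Not at hk
  obtain ⟨i, hi⟩ := hk
  refine le_trans ?_ (norm_le_pi_norm k i)
  rw [Int.norm_eq_abs]
  exact_mod_cast hi

/-- The difference counts the lattice points of sup norm `m`, which is `O(m^(n-1))`; the extra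
factor `m` avoids the exponent `n - 1`. -/
theorem mul_pow_sub_pow_le (n : ℕ) {m : ℝ} (hm : 1 ≤ m) :
    m * ((2 * m + 1) ^ n - (2 * m - 1) ^ n) ≤ 2 * 4 ^ n * m ^ n := by
  induction n with
  | zero => simp
  | succ n ih =>
    have h1 : (2 * m - 1) ^ n ≤ 4 ^ n * m ^ n := by
      rw [← mul_pow]
      exact pow_le_pow_left₀ (by linarith) (by linarith) n
    have h2 : (2 * m + 1) * (m * ((2 * m + 1) ^ n - (2 * m - 1) ^ n)) ≤
        3 * m * (2 * 4 ^ n * m ^ n) := by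
      calc _ ≤ (2 * m + 1) * (2 * 4 ^ n * m ^ n) :=
            mul_le_mul_of_nonneg_left ih (by linarith)
        _ ≤ _ := mul_le_mul_of_nonneg_right (by linarith) (by positivity)
    have h3 : m * (2 * m - 1) ^ n ≤ m * (4 ^ n * m ^ n) :=
      mul_le_mul_of_nonneg_left h1 (by linarith)
    calc m * ((2 * m + 1) ^ (n + 1) - (2 * m - 1) ^ (n + 1))
        = (2 * m + 1) * (m * ((2 * m + 1) ^ n - (2 * m - 1) ^ n)) +
          2 * (m * (2 * m - 1) ^ n) := by ring
      _ ≤ 3 * m * (2 * 4 ^ n * m ^ n) + 2 * (m * (4 ^ n * m ^ n)) := by linarith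
      _ = 2 * 4 ^ (n + 1) * m ^ (n + 1) := by ring

/-- A telescoping substitute for comparing `∑ m^(-q-1)` with an integral. It reduces to `J (J + 2) ≤
(J + 1)^2`. -/
theorem inv_pow_succ_le_sub {q : ℕ} (hq : 1 ≤ q) {J : ℝ} (hJ : 1 ≤ J) :
    ((J + 1) ^ (q + 1))⁻¹ ≤ (J ^ q)⁻¹ - ((J + 1) ^ q)⁻¹ := by
  obtain ⟨p, rfl⟩ := Nat.exists_eq_add_of_le' hq
  have hJ0 : 0 < J := by linarith
  have h1 : J ^ p ≤ (J + 1) ^ p := pow_le_pow_left₀ hJ0.le (by linarith) p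
  have h2 : J ^ (p + 1) * (J + 2) ≤ (J + 1) ^ (p + 1 + 1) := by
    calc J ^ (p + 1) * (J + 2) = J ^ p * (J * (J + 2)) := by ring
      _ ≤ (J + 1) ^ p * (J + 1) ^ 2 :=
        mul_le_mul h1 (by nlinarith) (by positivity) (by positivity)
      _ = _ := by ring
  have h3 : ((J + 1) ^ (p + 1))⁻¹ = (J + 1) * ((J + 1) ^ (p + 1 + 1))⁻¹ := by
    field_simp
    ring
  have h4 : (J + 2) * ((J + 1) ^ (p + 1 + 1))⁻¹ ≤ (J ^ (p + 1))⁻¹ := by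
    rw [← div_eq_mul_inv, div_le_iff₀ (by positivity), ← div_eq_inv_mul,
      le_div_iff₀ (by positivity)]
    linarith
  rw [h3]
  linarith

theorem sum_freqBox_succ_sdiff_le {s q J : ℕ} (hq : 1 ≤ q) (hs : 2 * s = n + q) (hJ : 1 ≤ J) :
    ∑ k ∈ freqBox n (J + 1) \ freqBox n J, ((‖k‖ : ℝ) ^ (2 * s))⁻¹ ≤
      2 * 4 ^ n * (((J : ℝ) ^ q)⁻¹ - ((J + 1 : ℝ) ^ q)⁻¹) := by
  have hJ' : (1 : ℝ) ≤ J := by exact_mod_cast hJ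
  have hcard : (((freqBox n (J + 1) \ freqBox n J).card : ℕ) : ℝ) =
      (2 * (J + 1 : ℝ) + 1) ^ n - (2 * (J + 1 : ℝ) - 1) ^ n := by
    rw [Finset.cast_card_sdiff (freqBox_mono J.le_succ), card_freqBox, card_freqBox]
    push_cast
    ring
  have h1 : ∀ k ∈ freqBox n (J + 1) \ freqBox n J,
      ((‖k‖ : ℝ) ^ (2 * s))⁻¹ ≤ ((J + 1 : ℝ) ^ (2 * s))⁻¹ := fun k hk =>
    inv_anti₀ (by positivity) (pow_le_pow_left₀ (by positivity)
      (le_norm_of_notMem_freqBox (Finset.mem_sdiff.1 hk).2) _)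
  calc _ ≤ (freqBox n (J + 1) \ freqBox n J).card • ((J + 1 : ℝ) ^ (2 * s))⁻¹ :=
        Finset.sum_le_card_nsmul _ _ _ h1
    _ = ((J + 1 : ℝ) * ((2 * (J + 1 : ℝ) + 1) ^ n - (2 * (J + 1 : ℝ) - 1) ^ n)) *
          ((J + 1 : ℝ) ^ (2 * s + 1))⁻¹ := by
        rw [nsmul_eq_mul, hcard]
        field_simp
        ring
    _ ≤ (2 * 4 ^ n * (J + 1 : ℝ) ^ n) * ((J + 1 : ℝ) ^ (2 * s + 1))⁻¹ :=
        mul_le_mul_of_nonneg_right (mul_pow_sub_pow_le n (by linarith)) (by positivity)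
    _ = 2 * 4 ^ n * ((J + 1 : ℝ) ^ (q + 1))⁻¹ := by
        rw [hs]
        field_simp
        ring
    _ ≤ _ := mul_le_mul_of_nonneg_left (inv_pow_succ_le_sub hq hJ') (by positivity)

theorem sum_freqBox_sdiff_le {s q K J : ℕ} (hq : 1 ≤ q) (hs : 2 * s = n + q) (hK : 1 ≤ K)
    (hKJ : K ≤ J) :
    ∑ k ∈ freqBox n J \ freqBox n K, ((‖k‖ : ℝ) ^ (2 * s))⁻¹ ≤
      2 * 4 ^ n * (((K : ℝ) ^ q)⁻¹ - ((J : ℝ) ^ q)⁻¹) := by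
  induction J, hKJ using Nat.le_induction with
  | base => simp
  | succ J hJ ih =>
    have h : freqBox n (J + 1) \ freqBox n K =
        (freqBox n (J + 1) \ freqBox n J) ∪ (freqBox n J \ freqBox n K) :=
      (Finset.sdiff_union_sdiff_cancel (freqBox_mono J.le_succ) (freqBox_mono hJ)).symm
    rw [h, Finset.sum_union]
    · have := sum_freqBox_succ_sdiff_le (n := n) hq hs (hK.trans hJ)
      push_cast
      linarith
    · exact Finset.disjoint_of_subset_right Finset.sdiff_subset Finset.sdiff_disjoint

theorem norm_pow_le_sum (k : Fin n → ℤ) (hn : 0 < n) (r : ℕ) :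
    ‖k‖ ^ r ≤ ∑ i, |(k i : ℝ)| ^ r := by
  have : Nonempty (Fin n) := ⟨⟨0, hn⟩⟩
  obtain ⟨i, hi⟩ := Finite.exists_max fun i => |(k i : ℝ)|
  have h : ‖k‖ ≤ |(k i : ℝ)| := by
    rw [pi_norm_le_iff_of_nonneg (abs_nonneg _)]
    intro j
    rw [Int.norm_eq_abs]
    exact hi j
  exact (pow_le_pow_left₀ (norm_nonneg _) h r).trans
    (Finset.single_le_sum (f := fun i => |(k i : ℝ)| ^ r) (fun _ _ => by positivity)
      (Finset.mem_univ i))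

theorem TorusContDiff.sum_sq_torusCoeff_mul_le {s : ℕ} {g : UnitAddTorus (Fin n) → ℝ}
    (hg : TorusContDiff s g) (hn : 0 < n) {L : ℝ}
    (hL : ∑ i, torusL2Norm (purePartial s i g) ≤ L) (F : Finset (Fin n → ℤ)) :
    ∑ k ∈ F, (‖torusCoeff g k‖ * ‖k‖ ^ s) ^ 2 ≤ (L / (2 * Real.pi) ^ s) ^ 2 := by
  have hpi := Real.pi_pos
  have h1 : ∀ i k, (|(k i : ℝ)| ^ (2 * s)) * ‖torusCoeff g k‖ ^ 2 =
      ‖torusCoeff (purePartial s i g) k‖ ^ 2 / ((2 * Real.pi) ^ s) ^ 2 := by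
    intro i k
    rw [hg.torusCoeff_purePartial i k]
    have : ‖(2 * Real.pi * Complex.I * k i : ℂ)‖ = 2 * Real.pi * |(k i : ℝ)| := by
      simp [abs_of_pos hpi]
    rw [norm_mul, norm_pow, this, eq_div_iff (by positivity)]
    ring
  calc ∑ k ∈ F, (‖torusCoeff g k‖ * ‖k‖ ^ s) ^ 2
      ≤ ∑ k ∈ F, ∑ i, (|(k i : ℝ)| ^ (2 * s)) * ‖torusCoeff g k‖ ^ 2 := by
        refine Finset.sum_le_sum fun k _ => ?_
        rw [← Finset.sum_mul, mul_pow, mul_comm, ← pow_mul, mul_comm s 2]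
        exact mul_le_mul_of_nonneg_right (norm_pow_le_sum k hn _) (by positivity)
    _ = ∑ i, (∑ k ∈ F, ‖torusCoeff (purePartial s i g) k‖ ^ 2) / ((2 * Real.pi) ^ s) ^ 2 := by
        rw [Finset.sum_comm]
        simp_rw [h1, Finset.sum_div]
    _ ≤ ∑ i, torusL2Norm (purePartial s i g) ^ 2 / ((2 * Real.pi) ^ s) ^ 2 := by
        refine Finset.sum_le_sum fun i _ => ?_
        gcongr
        exact sum_le_hasSum F (fun _ _ => sq_nonneg _)
          (hasSum_sq_torusCoeff (hg.continuous_purePartial i))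
    -- `L` bounds a sum of norms, whereas Parseval produces a sum of their squares.
    _ ≤ (∑ i, torusL2Norm (purePartial s i g)) ^ 2 / ((2 * Real.pi) ^ s) ^ 2 := by
        rw [← Finset.sum_div]
        gcongr
        exact Finset.sum_sq_le_sq_sum_of_nonneg fun i _ => torusL2Norm_nonneg _
    _ ≤ L ^ 2 / ((2 * Real.pi) ^ s) ^ 2 := by
        gcongr
        exact Finset.sum_nonneg fun i _ => torusL2Norm_nonneg _
    _ = _ := by rw [div_pow]

/-- The exponent of the threshold is `2 / q`. Its `q`-th power is exactly what makes the tail bound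
`2 * 4^n * (L / (2π)^s)^2 * K^(-q)` at most `δ^2`. -/
theorem freqBound_pow {s q : ℕ} (hq : 1 ≤ q) (hs : 2 * s = n + q) {L δ : ℝ} (hL : 0 ≤ L)
    (hδ : 0 < δ) :
    freqBound n s L δ ^ q = 2 * 4 ^ n * (L / (2 * Real.pi) ^ s) ^ 2 / δ ^ 2 := by
  have hpi := Real.pi_pos
  have hq' : (q : ℝ) ≠ 0 := by positivity
  have h : (2 * (s : ℝ) - n) = q := by
    have : (2 * s : ℝ) = n + q := by exact_mod_cast hs
    linarith
  rw [freqBound, h, ← Real.rpow_natCast, ← Real.rpow_mul (by positivity),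
    div_mul_cancel₀ _ hq', Real.rpow_two, div_pow, mul_pow, mul_pow, mul_pow,
    Real.sq_sqrt zero_le_two, ← pow_mul, mul_comm n 2, pow_mul]
  norm_num
  field_simp

theorem TorusContDiff.sum_norm_torusCoeff_le {s q : ℕ} {g : UnitAddTorus (Fin n) → ℝ}
    (hg : TorusContDiff s g) (hq : 1 ≤ q) (hs : 2 * s = n + q) {L δ : ℝ} (hδ : 0 < δ)
    (hL : ∑ i, torusL2Norm (purePartial s i g) ≤ L) (F : Finset (Fin n → ℤ))
    (hF : Disjoint F (freqBox n ⌈freqBound n s L δ⌉₊)) :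
    ∑ k ∈ F, ‖torusCoeff g k‖ ≤ δ := by
  set K := ⌈freqBound n s L δ⌉₊ with hK
  have hL0 : 0 ≤ L := (Finset.sum_nonneg fun i _ => torusL2Norm_nonneg _).trans hL
  rcases F.eq_empty_or_nonempty with rfl | ⟨k₀, hk₀⟩
  · simpa using hδ.le
  have hnorm : ∀ k ∈ F, 0 < ‖k‖ := fun k hk => by
    have := le_norm_of_notMem_freqBox (Finset.disjoint_left.1 hF hk)
    have hK0 : (0 : ℝ) ≤ K := Nat.cast_nonneg K
    linarith
  have hn : 0 < n := by
    rcases Nat.eq_zero_or_pos n with rfl | h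
    · have := hnorm k₀ hk₀
      simp [Subsingleton.elim k₀ 0] at this
    · exact h
  have hCS : (∑ k ∈ F, ‖torusCoeff g k‖) ^ 2 ≤
      (L / (2 * Real.pi) ^ s) ^ 2 * ∑ k ∈ F, ((‖k‖ : ℝ) ^ (2 * s))⁻¹ := by
    calc (∑ k ∈ F, ‖torusCoeff g k‖) ^ 2
        = (∑ k ∈ F, (‖torusCoeff g k‖ * ‖k‖ ^ s) * (‖k‖ ^ s)⁻¹) ^ 2 := by
          congr 1
          refine Finset.sum_congr rfl fun k hk => ?_
          have := hnorm k hk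
          field_simp
      _ ≤ (∑ k ∈ F, (‖torusCoeff g k‖ * ‖k‖ ^ s) ^ 2) * ∑ k ∈ F, ((‖k‖ ^ s)⁻¹) ^ 2 :=
          Finset.sum_mul_sq_le_sq_mul_sq _ _ _
      _ ≤ (L / (2 * Real.pi) ^ s) ^ 2 * ∑ k ∈ F, ((‖k‖ ^ s)⁻¹) ^ 2 := by
          gcongr
          exact hg.sum_sq_torusCoeff_mul_le hn hL F
      _ = _ := by simp_rw [inv_pow, ← pow_mul, mul_comm s 2]
  refine le_of_sq_le_sq (hCS.trans ?_) hδ.le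
  -- If `L = 0` the threshold may vanish and the lattice estimate, which needs `K ≥ 1`, does not
  -- apply; but then `hCS` already bounds the sum by `0`.
  rcases hL0.eq_or_lt with rfl | hLpos
  · simp [sq_nonneg]
  have hpi := Real.pi_pos
  have hfb : freqBound n s L δ ^ q ≤ (K : ℝ) ^ q :=
    pow_le_pow_left₀ (by rw [freqBound]; positivity) (Nat.le_ceil _) q
  have hK1 : 1 ≤ K := Nat.one_le_ceil_iff.2 (by rw [freqBound]; positivity)
  obtain ⟨J, hKJ, hFJ⟩ := exists_subset_freqBox F K
  have hsub : F ⊆ freqBox n J \ freqBox n K := fun k hk =>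
    Finset.mem_sdiff.2 ⟨hFJ hk, Finset.disjoint_left.1 hF hk⟩
  have hK1' : (0 : ℝ) < K := by exact_mod_cast hK1
  have hS : ∑ k ∈ F, ((‖k‖ : ℝ) ^ (2 * s))⁻¹ ≤ 2 * 4 ^ n * ((K : ℝ) ^ q)⁻¹ := by
    calc _ ≤ ∑ k ∈ freqBox n J \ freqBox n K, ((‖k‖ : ℝ) ^ (2 * s))⁻¹ :=
          Finset.sum_le_sum_of_subset_of_nonneg hsub fun _ _ _ => by positivity
      _ ≤ 2 * 4 ^ n * (((K : ℝ) ^ q)⁻¹ - ((J : ℝ) ^ q)⁻¹) :=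
          sum_freqBox_sdiff_le hq hs hK1 hKJ
      _ ≤ _ := by
          gcongr
          exact sub_le_self _ (by positivity)
  rw [freqBound_pow hq hs hL0 hδ, div_le_iff₀ (by positivity)] at hfb
  calc (L / (2 * Real.pi) ^ s) ^ 2 * ∑ k ∈ F, ((‖k‖ : ℝ) ^ (2 * s))⁻¹
      ≤ (L / (2 * Real.pi) ^ s) ^ 2 * (2 * 4 ^ n * ((K : ℝ) ^ q)⁻¹) := by gcongr
    _ = (2 * 4 ^ n * (L / (2 * Real.pi) ^ s) ^ 2) * ((K : ℝ) ^ q)⁻¹ := by ring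
    _ ≤ ((K : ℝ) ^ q * δ ^ 2) * ((K : ℝ) ^ q)⁻¹ := by gcongr
    _ = δ ^ 2 := by field_simp

/-- Truncating the Fourier series at the frequency threshold changes `g` by at most `δ`. -/
theorem TorusContDiff.norm_sub_sum_le {s q : ℕ} {g : UnitAddTorus (Fin n) → ℝ}
    (hg : TorusContDiff s g) (hq : 1 ≤ q) (hs : 2 * s = n + q) {L δ : ℝ} (hδ : 0 < δ)
    (hL : ∑ i, torusL2Norm (purePartial s i g) ≤ L) (u : UnitAddTorus (Fin n)) :
    ‖(g u : ℂ) - ∑ k ∈ freqBox n ⌈freqBound n s L δ⌉₊,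
      torusCoeff g k * UnitAddTorus.mFourier k u‖ ≤ δ := by
  set B := freqBox n ⌈freqBound n s L δ⌉₊
  -- The tail estimate over finite sets itself yields absolute summability, hence pointwise
  -- convergence to `g`.
  have hsum : Summable fun k => ‖torusCoeff g k‖ := by
    refine summable_of_sum_le (c := δ + ∑ k ∈ B, ‖torusCoeff g k‖) (fun _ => norm_nonneg _)
      fun F => ?_
    have h1 := hg.sum_norm_torusCoeff_le hq hs hδ hL (F \ B) Finset.sdiff_disjoint
    calc ∑ k ∈ F, ‖torusCoeff g k‖ ≤ ∑ k ∈ (F \ B) ∪ B, ‖torusCoeff g k‖ := by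
          refine Finset.sum_le_sum_of_subset_of_nonneg ?_ fun _ _ _ => norm_nonneg _
          rw [Finset.sdiff_union_self_eq_union]
          exact Finset.subset_union_left
      _ = ∑ k ∈ F \ B, ‖torusCoeff g k‖ + ∑ k ∈ B, ‖torusCoeff g k‖ :=
          Finset.sum_union Finset.sdiff_disjoint
      _ ≤ _ := by gcongr
  have hlim := hasSum_torusCoeff_mul_mFourier hg.continuous hsum u
  refine le_of_tendsto ((Filter.Tendsto.sub_const hlim _).norm) ?_
  filter_upwards [Filter.eventually_ge_atTop B] with F hF
  rw [← Finset.sum_sdiff hF, add_sub_cancel_right]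
  calc _ ≤ ∑ k ∈ F \ B, ‖torusCoeff g k * UnitAddTorus.mFourier k u‖ := norm_sum_le _ _
    _ ≤ ∑ k ∈ F \ B, ‖torusCoeff g k‖ := by
        refine Finset.sum_le_sum fun k _ => ?_
        rw [norm_mul]
        exact mul_le_of_le_one_right (norm_nonneg _) (norm_mFourier_apply_le k u)
    _ ≤ δ := hg.sum_norm_torusCoeff_le hq hs hδ hL _ Finset.sdiff_disjoint

theorem norm_sum_mul_mFourier_le (B : Finset (Fin n → ℤ)) (c : (Fin n → ℤ) → ℂ)
    (u : UnitAddTorus (Fin n)) :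
    ‖∑ k ∈ B, c k * UnitAddTorus.mFourier k u‖ ≤ ∑ k ∈ B, ‖c k‖ := by
  refine (norm_sum_le _ _).trans (Finset.sum_le_sum fun k _ => ?_)
  rw [norm_mul]
  exact mul_le_of_le_one_right (norm_nonneg _) (norm_mFourier_apply_le k u)

theorem TorusContDiff.abs_le {s q : ℕ} {g : UnitAddTorus (Fin n) → ℝ}
    (hg : TorusContDiff s g) (hq : 1 ≤ q) (hs : 2 * s = n + q) {L M δ : ℝ} (hδ : 0 < δ)
    (hL : ∑ i, torusL2Norm (purePartial s i g) ≤ L) (hM : torusL2Norm g ≤ M)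
    (u : UnitAddTorus (Fin n)) :
    |g u| ≤ ((2 * ⌈freqBound n s L δ⌉₊ + 1) ^ n : ℕ) * M + δ := by
  have h1 := hg.norm_sub_sum_le hq hs hδ hL u
  have h2 := norm_sum_mul_mFourier_le (freqBox n ⌈freqBound n s L δ⌉₊) (torusCoeff g) u
  have h3 : ∑ k ∈ freqBox n ⌈freqBound n s L δ⌉₊, ‖torusCoeff g k‖ ≤
      ((2 * ⌈freqBound n s L δ⌉₊ + 1) ^ n : ℕ) * M := by
    rw [← card_freqBox, ← nsmul_eq_mul]
    exact Finset.sum_le_card_nsmul _ _ _ fun k _ =>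
      (norm_torusCoeff_le hg.continuous k).trans hM
  have h4 := norm_sub_norm_le (g u : ℂ) (∑ k ∈ freqBox n ⌈freqBound n s L δ⌉₊,
      torusCoeff g k * UnitAddTorus.mFourier k u)
  rw [Complex.norm_real, Real.norm_eq_abs] at h4
  linarith

theorem TorusContDiff.abs_sub_le {s q : ℕ} {g g' : UnitAddTorus (Fin n) → ℝ}
    (hg : TorusContDiff s g) (hg' : TorusContDiff s g') (hq : 1 ≤ q) (hs : 2 * s = n + q)
    {L δ : ℝ} (hδ : 0 < δ) (hL : ∑ i, torusL2Norm (purePartial s i g) ≤ L)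
    (hL' : ∑ i, torusL2Norm (purePartial s i g') ≤ L) (u : UnitAddTorus (Fin n)) :
    |g u - g' u| ≤ 2 * δ + ∑ k ∈ freqBox n ⌈freqBound n s L δ⌉₊,
      ‖torusCoeff g k - torusCoeff g' k‖ := by
  have h1 := hg.norm_sub_sum_le hq hs hδ hL u
  have h1' := hg'.norm_sub_sum_le hq hs hδ hL' u
  have h2 := norm_sum_mul_mFourier_le (freqBox n ⌈freqBound n s L δ⌉₊)
    (fun k => torusCoeff g k - torusCoeff g' k) u
  simp_rw [sub_mul, Finset.sum_sub_distrib] at h2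
  set S := ∑ k ∈ freqBox n ⌈freqBound n s L δ⌉₊, torusCoeff g k * UnitAddTorus.mFourier k u
  set S' := ∑ k ∈ freqBox n ⌈freqBound n s L δ⌉₊, torusCoeff g' k * UnitAddTorus.mFourier k u
  rw [← Real.norm_eq_abs, ← Complex.norm_real]
  have h3 : ((g u - g' u : ℝ) : ℂ) = ((g u : ℂ) - S) - ((g' u : ℂ) - S') + (S - S') := by
    push_cast
    ring
  rw [h3]
  have h4 := norm_add_le (((g u : ℂ) - S) - ((g' u : ℂ) - S')) (S - S')
  have h5 := norm_sub_le ((g u : ℂ) - S) ((g' u : ℂ) - S')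
  linarith

end Torus

end Scenario

namespace Scenario

/-! ### Finite nets by rounding coefficients. -/

/-- A bounded family of complex vectors indexed by `B` has a finite net in the sup norm, obtained
by rounding all real and imaginary parts to a grid of mesh `h`. -/
theorem exists_finset_net {X ι : Type*} (B : Finset ι) (c : X → ι → ℂ) {M h : ℝ} (hM : 0 ≤ M)
    (hh : 0 < h) (hc : ∀ x k, ‖c x k‖ ≤ M) :
    ∃ T : Finset X, (T.card : ℝ) ≤ ((2 * M / h + 2) ^ 2) ^ B.card ∧
      ∀ x, ∃ y ∈ T, ∀ k ∈ B, ‖c x k - c y k‖ ≤ 2 * h := by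
  classical
  let cell : X → B → ℤ × ℤ := fun x k => (⌊(c x k).re / h⌋, ⌊(c x k).im / h⌋)
  let I : Finset ℤ := Finset.Icc ⌊-M / h⌋ ⌊M / h⌋
  let R : Finset (B → ℤ × ℤ) := Fintype.piFinset fun _ => I ×ˢ I
  have hmem : ∀ a : ℝ, |a| ≤ M → ⌊a / h⌋ ∈ I := fun a ha => by
    rw [abs_le] at ha
    exact Finset.mem_Icc.2 ⟨Int.floor_mono (div_le_div_of_nonneg_right ha.1 hh.le),
      Int.floor_mono (div_le_div_of_nonneg_right ha.2 hh.le)⟩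
  have hcell : ∀ x, cell x ∈ R := fun x => Fintype.mem_piFinset.2 fun k => Finset.mem_product.2
    ⟨hmem _ ((Complex.abs_re_le_norm _).trans (hc x k)),
      hmem _ ((Complex.abs_im_le_norm _).trans (hc x k))⟩
  have hI : (I.card : ℝ) ≤ 2 * M / h + 2 := by
    have h0 : 0 ≤ ⌊M / h⌋ + 1 - ⌊-M / h⌋ := by
      have : ⌊-M / h⌋ ≤ ⌊M / h⌋ :=
        Int.floor_mono (div_le_div_of_nonneg_right (by linarith) hh.le)
      linarith
    rw [Int.card_Icc]
    have h1 : (((⌊M / h⌋ + 1 - ⌊-M / h⌋).toNat : ℕ) : ℝ) = ⌊M / h⌋ + 1 - ⌊-M / h⌋ := by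
      have := Int.toNat_of_nonneg h0
      exact_mod_cast congrArg (Int.cast (R := ℝ)) this
    rw [h1]
    have h2 := Int.floor_le (M / h)
    have h3 := Int.lt_floor_add_one (-M / h)
    have h4 : 2 * M / h = M / h - -M / h := by ring
    linarith
  have hR : (R.card : ℝ) ≤ ((2 * M / h + 2) ^ 2) ^ B.card := by
    rw [Fintype.card_piFinset, Finset.prod_const, Finset.card_univ, Fintype.card_coe,
      Finset.card_product, ← pow_two]
    push_cast
    exact pow_le_pow_left₀ (by positivity) (pow_le_pow_left₀ (by positivity) hI 2) _
  have hclose : ∀ a b : ℝ, ⌊a / h⌋ = ⌊b / h⌋ → |a - b| ≤ h := fun a b hab => by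
    have h1 := Int.abs_sub_lt_one_of_floor_eq_floor hab
    rw [← sub_div, abs_div, abs_of_pos hh, div_lt_one hh] at h1
    exact h1.le
  -- Only occupied cells get a representative, so the net consists of actual members of `X`, to
  -- which the tail probability applies.
  let S := R.filter fun r => ∃ x, cell x = r
  choose rep hrep using fun r : S => (Finset.mem_filter.1 r.2).2
  refine ⟨S.attach.image rep, ?_, fun x => ?_⟩
  · refine le_trans ?_ hR
    have h1 : (S.attach.image rep).card ≤ R.card :=
      Finset.card_image_le.trans (by
        rw [Finset.card_attach]
        exact Finset.card_filter_le _ _)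
    exact_mod_cast h1
  · have hx : cell x ∈ S := Finset.mem_filter.2 ⟨hcell x, x, rfl⟩
    refine ⟨rep ⟨cell x, hx⟩, Finset.mem_image_of_mem _ (Finset.mem_attach _ _), fun k hk => ?_⟩
    have h1 : cell (rep ⟨cell x, hx⟩) ⟨k, hk⟩ = cell x ⟨k, hk⟩ :=
      congrFun (hrep ⟨cell x, hx⟩) ⟨k, hk⟩
    have h2 := Complex.norm_le_abs_re_add_abs_im (c x k - c (rep ⟨cell x, hx⟩) k)
    have h3 := hclose _ _ (congrArg Prod.fst h1).symm
    have h4 := hclose _ _ (congrArg Prod.snd h1).symm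
    rw [Complex.sub_re, Complex.sub_im] at h2
    linarith

/-! ### Union bound over the net, and the numerical constants. -/

/-- The probability that `N` independent samples all miss the upper tail of a fixed decision. -/
theorem measureReal_pi_forall_le {X Ξ : Type*} [MeasurableSpace Ξ] (P : Measure Ξ)
    [IsProbabilityMeasure P] (f : X → Ξ → ℝ) (y : X) (hy : Measurable (f y)) (N : ℕ) (ε : ℝ) :
    (Measure.pi fun _ : Fin N => P).real {u | ∀ i, f y (u i) ≤ robustValue f - ε} ≤
      Real.exp (-(N : ℝ) * infTailProb P f ε) := by
  have hset : {u : Fin N → Ξ | ∀ i, f y (u i) ≤ robustValue f - ε} =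
      Set.univ.pi fun _ : Fin N => {u | robustValue f - ε < f y u}ᶜ := by
    ext u
    simp
  have hms : MeasurableSet {u | robustValue f - ε < f y u} := measurableSet_lt measurable_const hy
  rw [hset, measureReal_def, Measure.pi_pi, Finset.prod_const, Finset.card_univ,
    Fintype.card_fin, ENNReal.toReal_pow, ← measureReal_def, probReal_compl_eq_one_sub hms]
  have h1 : infTailProb P f ε ≤ tailProb P f y ε :=
    ciInf_le ⟨0, by rintro _ ⟨x, rfl⟩; exact measureReal_nonneg⟩ y
  have h2 : P.real {u | robustValue f - ε < f y u} ≤ 1 := measureReal_le_one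
  calc (1 - P.real {u | robustValue f - ε < f y u}) ^ N
      ≤ Real.exp (-infTailProb P f ε) ^ N := by
        refine pow_le_pow_left₀ (by linarith) ?_ N
        have h3 := Real.add_one_le_exp (-infTailProb P f ε)
        have h4 : infTailProb P f ε ≤ P.real {u | robustValue f - ε < f y u} := h1
        linarith
    _ = _ := by
        rw [← Real.exp_nat_mul]
        congr 1
        ring

/-- If every decision is uniformly `η`-close to a member of the finite set `T`, the bad set has
probability at most `#T` times that of missing the tail of one decision. -/
theorem badSetProb_le_card_mul_exp {X Ξ : Type*} [Nonempty X] [MeasurableSpace Ξ] (P : Measure Ξ)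
    [IsProbabilityMeasure P] (f : X → Ξ → ℝ) (hf : ∀ x, Measurable (f x)) (T : Finset X)
    {η ε ε' : ℝ} (hη : η < ε - ε') (hT : ∀ x, ∃ y ∈ T, ∀ u, |f x u - f y u| ≤ η) (N : ℕ) :
    badSetProb P f N ε ≤ T.card * Real.exp (-(N : ℝ) * infTailProb P f ε') := by
  have hsub : badSet f N ε ⊆ ⋃ y ∈ T, {u | ∀ i, f y (u i) ≤ robustValue f - ε'} := by
    intro u hu
    -- The strict gap `η < ε - ε'` produces a near-optimal `x` although the infimum need not be
    -- attained.
    have hu' : scenarioValue f u < robustValue f - ε' - η := by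
      have : scenarioValue f u ≤ robustValue f - ε := hu
      linarith
    obtain ⟨x, hx⟩ := exists_lt_of_ciInf_lt hu'
    obtain ⟨y, hy, hxy⟩ := hT x
    simp only [Set.mem_iUnion, Set.mem_ofPred_eq]
    refine ⟨y, hy, fun i => ?_⟩
    have h1 : f x (u i) ≤ ⨆ i, f x (u i) :=
      le_ciSup (f := fun i => f x (u i)) (Set.finite_range _).bddAbove i
    have h2 := (abs_le.1 (hxy (u i))).1
    linarith
  calc badSetProb P f N ε
      ≤ (Measure.pi fun _ : Fin N => P).real
          (⋃ y ∈ T, {u | ∀ i, f y (u i) ≤ robustValue f - ε'}) :=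
        measureReal_mono hsub (measure_ne_top _ _)
    _ ≤ ∑ y ∈ T, (Measure.pi fun _ : Fin N => P).real
          {u | ∀ i, f y (u i) ≤ robustValue f - ε'} := measureReal_biUnion_finset_le _ _
    _ ≤ ∑ _y ∈ T, Real.exp (-(N : ℝ) * infTailProb P f ε') :=
        Finset.sum_le_sum fun y _ => measureReal_pi_forall_le P f y (hf y) N ε'
    _ = _ := by rw [Finset.sum_const, nsmul_eq_mul]

/-- If the cost is bounded by `b` in absolute value, no sample is bad for an accuracy above
`2 * b`. -/
theorem badSet_eq_empty {X Ξ : Type*} [Nonempty X] [Nonempty Ξ] {f : X → Ξ → ℝ} {b ε : ℝ}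
    (hb : ∀ x u, |f x u| ≤ b) (hε : 2 * b < ε) {N : ℕ} (hN : 0 < N) : badSet f N ε = ∅ := by
  rw [Set.eq_empty_iff_forall_notMem]
  intro u hu
  have hrob : robustValue f ≤ b := by
    obtain ⟨x₀⟩ := ‹Nonempty X›
    obtain ⟨u₀⟩ := ‹Nonempty Ξ›
    have hbdd : ∀ x, BddAbove (Set.range (f x)) := fun x =>
      ⟨b, by rintro _ ⟨v, rfl⟩; exact (abs_le.1 (hb x v)).2⟩
    refine (ciInf_le ⟨-b, ?_⟩ x₀).trans ?_
    · rintro _ ⟨x, rfl⟩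
      exact (abs_le.1 (hb x u₀)).1.trans (le_ciSup (hbdd x) u₀)
    · have : Nonempty Ξ := ⟨u₀⟩
      exact ciSup_le fun v => (abs_le.1 (hb x₀ v)).2
  have hscen : -b ≤ scenarioValue f u := le_ciInf fun x =>
    (abs_le.1 (hb x (u ⟨0, hN⟩))).1.trans
      (le_ciSup (f := fun i => f x (u i)) (Set.finite_range _).bddAbove ⟨0, hN⟩)
  have hu' : scenarioValue f u ≤ robustValue f - ε := hu
  linarith

/-- With `m = D * M / ε` the base on the left is `(8m + 2)^2`. As `m ≥ 3/8`, four times it is at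
most `288 π m^2`, and the spare `4^D` absorbs the factor `1 / D`. -/
theorem net_card_le {D : ℕ} (hD : 1 ≤ D) {M ε : ℝ} (hε : 0 < ε) (hM : 3 / 8 * ε ≤ D * M) :
    ((2 * M / (ε / (4 * D)) + 2) ^ 2) ^ D ≤
      1 / (D : ℝ) * (Real.pi * (D : ℝ) ^ 2 / 2) ^ D * (ε / (24 * M)) ^ (-2 * (D : ℤ)) := by
  have hD0 : (0 : ℝ) < D := by exact_mod_cast hD
  have hMpos : 0 < M := by
    by_contra h
    nlinarith
  have hm : 3 / 8 ≤ D * M / ε := by rwa [le_div_iff₀ hε]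
  set m := D * M / ε with hmdef
  have h1 : 2 * M / (ε / (4 * D)) = 8 * m := by
    rw [hmdef]
    field_simp
    ring
  have h2 : (ε / (24 * M)) ^ (-2 * (D : ℤ)) = ((24 * M / ε) ^ 2) ^ D := by
    rw [neg_mul, zpow_neg, ← inv_zpow, inv_div, zpow_mul]
    norm_cast
  have h3 : 4 * (8 * m + 2) ^ 2 ≤ Real.pi * (D : ℝ) ^ 2 / 2 * (24 * M / ε) ^ 2 := by
    have h4 : Real.pi * (D : ℝ) ^ 2 / 2 * (24 * M / ε) ^ 2 = 288 * Real.pi * m ^ 2 := by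
      rw [hmdef]
      field_simp
      ring
    rw [h4]
    nlinarith [Real.pi_gt_three, sq_nonneg m]
  have h5 : (D : ℝ) ≤ 4 ^ D := by exact_mod_cast (Nat.lt_pow_self (by norm_num)).le
  rw [h1, h2, mul_assoc, ← mul_pow, one_div, ← div_eq_inv_mul, le_div_iff₀ hD0]
  calc ((8 * m + 2) ^ 2) ^ D * D ≤ ((8 * m + 2) ^ 2) ^ D * 4 ^ D := by gcongr
    _ = (4 * (8 * m + 2) ^ 2) ^ D := by rw [← mul_pow, mul_comm]
    _ ≤ _ := pow_le_pow_left₀ (by positivity) h3 D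

end Scenario

/-! ### Assembly of the bound. -/

theorem theorem3p6 {d n s : ℕ}
    -- the decision set, the cost function, and the distribution on the torus
    (X : Set (EuclideanSpace ℝ (Fin d))) (hX : X.Nonempty)
    (f : X → UnitAddTorus (Fin n) → ℝ)
    (hlsc : LowerSemicontinuous fun p : X × UnitAddTorus (Fin n) => f p.1 p.2)
    (P : MeasureTheory.Measure (UnitAddTorus (Fin n))) [MeasureTheory.IsProbabilityMeasure P]
    [P.IsOpenPosMeasure]
    -- smoothness in the uncertain parameter
    (hs : (n : ℝ) / 2 < s) (hf : ∀ x, Scenario.TorusContDiff s (f x))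
    -- `M` and `L` are the two suprema, which are finite
    (M L : ℝ) (hM : IsLUB (Set.range fun x => Scenario.torusL2Norm (f x)) M)
    (hL : IsLUB (Set.range fun x =>
      ∑ i, Scenario.torusL2Norm (Scenario.purePartial s i (f x))) L)
    (N : ℕ) (hN : 0 < N) (ε : ℝ) (hε : 0 < ε) :
    Scenario.badSetProb P f N ε ≤
      1 / (Scenario.trigDim n s L ε : ℝ) *
        (Real.pi * (Scenario.trigDim n s L ε : ℝ) ^ 2 / 2) ^ Scenario.trigDim n s L ε *
        (ε / (24 * M)) ^ (-2 * (Scenario.trigDim n s L ε : ℤ)) *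
        Real.exp (-(N : ℝ) * Scenario.infTailProb P f (ε / 4)) := by
  have : Nonempty X := hX.to_subtype
  have hlt : n < 2 * s := by
    have h : (n : ℝ) < 2 * s := by linarith
    exact_mod_cast h
  obtain ⟨q, hq⟩ := Nat.exists_eq_add_of_le hlt.le
  have hq1 : 1 ≤ q := by omega
  have hMx : ∀ x, Scenario.torusL2Norm (f x) ≤ M := fun x => hM.1 ⟨x, rfl⟩
  have hLx : ∀ x, ∑ i, Scenario.torusL2Norm (Scenario.purePartial s i (f x)) ≤ L :=
    fun x => hL.1 ⟨x, rfl⟩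
  have hM0 : 0 ≤ M := (Scenario.torusL2Norm_nonneg _).trans (hMx (Classical.arbitrary X))
  have hδ : 0 < ε / 12 := by positivity
  have habs : ∀ x u, |f x u| ≤ Scenario.trigDim n s L ε * M + ε / 12 := fun x u =>
    (hf x).abs_le hq1 hq hδ (hLx x) (hMx x) u
  have hD1 : 1 ≤ Scenario.trigDim n s L ε := Nat.one_le_pow _ _ (Nat.succ_pos _)
  have hcard : (Scenario.freqBox n ⌈Scenario.freqBound n s L (ε / 12)⌉₊).card =
      Scenario.trigDim n s L ε := Scenario.card_freqBox _ _
  generalize Scenario.trigDim n s L ε = D at *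
  have hD0 : (0 : ℝ) < D := by exact_mod_cast hD1
  rcases lt_or_ge (D * M) (3 / 8 * ε) with hsmall | hlarge
  -- Here `2 (3ε/8 + ε/12) = 11ε/12 < ε`. This case includes `M = 0`, and only nonnegativity of the
  -- right side is needed.
  · rw [Scenario.badSetProb, Scenario.badSet_eq_empty habs (by linarith) hN, measureReal_empty]
    exact mul_nonneg (mul_nonneg (by positivity) (zpow_nonneg (by positivity) _))
      (Real.exp_pos _).le
  obtain ⟨T, hTcard, hT⟩ := Scenario.exists_finset_net
    (Scenario.freqBox n ⌈Scenario.freqBound n s L (ε / 12)⌉₊)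
    (fun x => Scenario.torusCoeff (f x)) hM0 (h := ε / (4 * D)) (by positivity)
    (fun x k => (Scenario.norm_torusCoeff_le (hf x).continuous k).trans (hMx x))
  rw [hcard] at hTcard
  have hclose : ∀ x, ∃ y ∈ T, ∀ u, |f x u - f y u| ≤ 2 * ε / 3 := by
    intro x
    obtain ⟨y, hy, hxy⟩ := hT x
    refine ⟨y, hy, fun u => ?_⟩
    have h1 := (hf x).abs_sub_le (hf y) hq1 hq hδ (hLx x) (hLx y) u
    have h2 := Finset.sum_le_card_nsmul _ _ _ hxy
    rw [hcard, nsmul_eq_mul] at h2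
    -- Rounding costs `ε/2` and the two truncations cost `2 * ε/12`, in total `2ε/3`.
    have h3 : (D : ℝ) * (2 * (ε / (4 * D))) = ε / 2 := by
      field_simp
      ring
    linarith
  refine (Scenario.badSetProb_le_card_mul_exp P f (fun x => (hf x).continuous.measurable) T
    (ε' := ε / 4) (by linarith) hclose N).trans ?_
  exact mul_le_mul_of_nonneg_right
    (hTcard.trans (Scenario.net_card_le hD1 hε hlarge)) (Real.exp_pos _).le
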